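/- Let $0<\varepsilon<1$, $c=-\log(1-\varepsilon)>0$, $\alpha>0$ and $\xi\in[0,1)$. For $n\ge 1$ let $Y_1,\dots,Y_n$ be i.i.d. exponential random variables of mean $1$ (the normalized received powers of $n$ packets sent simultaneously), with descending order statistics $Y_{(1)}\ge\dots\ge Y_{(n)}$. For a target $\gamma>0$, successive interference cancellation (SIC) decodes the $m$-th strongest packet if and only if $$\frac{Y_{(j)}}{\,c/\gamma+\sum_{r=j+1}^{n}Y_{(r)}+\xi\sum_{r=1}^{j-1}Y_{(r)}\,}\ \ge\ \gamma\qquad\text{for all } j=1,\dots,m .$$ Let $m_n(\gamma)$ be the mean number of decoded packets, and let $U_n(\gamma)=\log_2(1+\gamma)\,m_n(\gamma)$ be the sum-rate. For $x\in(0,1]$ put $$f_{\alpha,\xi}(x)=-\Bigl(1+\frac{(1-\xi)x}{\alpha}\Bigr)\log x-\frac{1-(1-\xi)x}{\alpha},$$ $$\zeta=\sup\bigl\{x\in(0,1]: f_{\alpha,\xi}(z)\ge c\ \text{ for all } z\in(0,x)\bigr\}.$$ Assume that $f_{\alpha,\xi}$ does not take the value $c$ on $(0,\zeta)$, i.e.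 that $\zeta$ is the smallest root of $f_{\alpha,\xi}(x)=c$ (this fails only in the critical case in which $f_{\alpha,\xi}$ has an interior local minimum with value exactly $c$; it always holds if $\alpha\ge(1-\xi)/e$). Then, with $\gamma_n=1/(\alpha n)$, as $n\to\infty$, $$m_n(\gamma_n)\sim\zeta n\qquad\text{and}\qquad U_n(\gamma_n)\to\frac{\zeta}{\alpha\log 2}.$$ -/

import Mathlib

open Filter Topology Asymptotics MeasureTheory ProbabilityTheory

namespace SIC

/-- The constant `c = -log (1 - ε)`, where `ε` is the outage probability that is tolerated for
a packet which is transmitted alone; the target average signal-to-noise ratio is `γ / c`. -/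
noncomputable def outageConst (ε : ℝ) : ℝ := -Real.log (1 - ε)

/-- Descending order statistics of the received powers `y`. Ranks are counted from `0`:
`orderStat y k` is the `(k + 1)`-th largest entry of `y`. -/
noncomputable def orderStat {n : ℕ} (y : Fin n → ℝ) (k : Fin n) : ℝ :=
  y (Tuple.sort (fun i => -y i) k)

/-- The signal to noise plus interference ratio of the packet of rank `j`, when all stronger
packets have been decoded and cancelled with residual interference fraction `ξ`; powers are
normalized by the common average received power, so that the noise has power `c / γ`. -/
noncomputable def snir (c ξ γ : ℝ) {n : ℕ} (y : Fin n → ℝ) (j : Fin n) : ℝ :=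
  orderStat y j /
    (c / γ + ∑ r ∈ Finset.Ioi j, orderStat y r + ξ * ∑ r ∈ Finset.Iio j, orderStat y r)

/-- The packet of rank `m` is decoded if and only if the ratio of every packet of rank `j ≤ m`
is at least the target `γ`. -/
def IsDecoded (c ξ γ : ℝ) {n : ℕ} (y : Fin n → ℝ) (m : Fin n) : Prop :=
  ∀ j ≤ m, γ ≤ snir c ξ γ y j

/-- The number of correctly decoded packets. -/
noncomputable def numDecoded (c ξ γ : ℝ) {n : ℕ} (y : Fin n → ℝ) : ℕ :=
  Nat.card {m : Fin n // IsDecoded c ξ γ y m}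

/-- The mean number `m_n(γ)` of correctly decoded packets when `n` nodes transmit and their
received powers are i.i.d. exponential random variables of mean `1`. -/
noncomputable def meanDecoded (c ξ : ℝ) (n : ℕ) (γ : ℝ) : ℝ :=
  ∫ y : Fin n → ℝ, (numDecoded c ξ γ y : ℝ) ∂(Measure.pi fun _ => expMeasure 1)

/-- The sum-rate `U_n(γ) = log₂ (1 + γ) * m_n(γ)`. -/
noncomputable def sumRate (c ξ : ℝ) (n : ℕ) (γ : ℝ) : ℝ :=
  Real.logb 2 (1 + γ) * meanDecoded c ξ n γ

/-- The limiting profile `f_{α,ξ}`. -/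
noncomputable def profile (α ξ x : ℝ) : ℝ :=
  -(1 + (1 - ξ) * x / α) * Real.log x - (1 - (1 - ξ) * x) / α

/-- `ζ = sup {x ∈ (0,1] : f_{α,ξ}(z) ≥ c for all z ∈ (0,x)}`. -/
noncomputable def zeta (α ξ c : ℝ) : ℝ :=
  sSup {x | x ∈ Set.Ioc (0 : ℝ) 1 ∧ ∀ z ∈ Set.Ioo 0 x, c ≤ profile α ξ z}

end SIC

/-! ### Exponential law and a weak law of large numbers -/

namespace SIC

/-! At a packet of power `t`, interference divided by `n` concentrates at `1 - (1 + t)e⁻ᵗ + ξ(1 +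
t)e⁻ᵗ`: weaker packets count fully, stronger ones with weight `ξ`. For `γ = 1/(αn)`, decodability
becomes: this is at most `α(t - c)`. Substituting `x = e⁻ᵗ`, the limiting fraction of packets of
power at least `t`, gives `f(x) ≥ c` (`profile_exp_neg`).

Below `ζ` the root assumption makes the inequality strict. Chebyshev on short power intervals,
compactness, and a crude bound for large powers show that with high probability no packet above the
threshold fails (`tendsto_failSet_Ici`). Just above `ζ` there is a threshold where the inequality is
reversed, and the first packet below it fails with high probability (`numDecoded_le_countGe`).
Either way the decoded number is compared with a count of mean `ne⁻ᵗ`; exceptional events cost at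
most `n` times their probability. -/

instance isProbabilityMeasure_expMeasure_one : IsProbabilityMeasure (expMeasure 1) :=
  isProbabilityMeasure_expMeasure one_pos

lemma expMeasure_one_eq :
    expMeasure 1 = (volume.restrict (Set.Ioi 0)).withDensity
      (fun x => ENNReal.ofReal (Real.exp (-x))) := by
  have h : expMeasure 1 = volume.withDensity
      ((Set.Ici 0).indicator fun x => ENNReal.ofReal (Real.exp (-x))) := by
    refine congrArg (fun g => volume.withDensity g) (funext fun x => ?_)
    have hx := exponentialPDF_eq 1 x
    rw [exponentialPDF, exponentialPDFReal] at hx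
    rw [gammaPDF, hx]
    by_cases h0 : 0 ≤ x <;> simp [h0, Set.indicator]
  rw [h, withDensity_indicator measurableSet_Ici, Measure.restrict_congr_set Ioi_ae_eq_Ici.symm]

lemma integral_expMeasure_one (g : ℝ → ℝ) :
    ∫ x, g x ∂(expMeasure 1) = ∫ x in Set.Ioi 0, Real.exp (-x) * g x := by
  rw [expMeasure_one_eq, integral_withDensity_eq_integral_toReal_smul (by fun_prop) (by simp)]
  simp [ENNReal.toReal_ofReal (Real.exp_pos _).le]

lemma integrable_expMeasure_one_iff (g : ℝ → ℝ) :
    Integrable g (expMeasure 1) ↔ IntegrableOn (fun x => Real.exp (-x) * g x) (Set.Ioi 0) := by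
  rw [expMeasure_one_eq, integrable_withDensity_iff_integrable_smul' (by fun_prop) (by simp)]
  simp [ENNReal.toReal_ofReal (Real.exp_pos _).le, IntegrableOn]

lemma ae_expMeasure_one_nonneg : ∀ᵐ x ∂(expMeasure 1), 0 ≤ x := by
  rw [expMeasure_one_eq]
  refine (withDensity_absolutelyContinuous _ _).ae_le ?_
  filter_upwards [ae_restrict_mem measurableSet_Ioi] with x hx using le_of_lt hx

lemma memLp_two_id_expMeasure_one : MemLp (fun x : ℝ => x) 2 (expMeasure 1) := by
  rw [memLp_two_iff_integrable_sq (by fun_prop), integrable_expMeasure_one_iff]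
  have h := Real.GammaIntegral_convergent (s := 3) (by norm_num)
  refine h.congr_fun (fun x _ => ?_) measurableSet_Ioi
  norm_num

lemma integrable_id_expMeasure_one : Integrable (fun x : ℝ => x) (expMeasure 1) :=
  memLp_two_id_expMeasure_one.integrable (by norm_num)

lemma setIntegral_one_expMeasure_one {t : ℝ} (ht : 0 ≤ t) :
    ∫ x, (Set.Ici t).indicator (fun _ => (1 : ℝ)) x ∂(expMeasure 1) = Real.exp (-t) := by
  rw [integral_expMeasure_one]
  have : ∀ x, Real.exp (-x) * (Set.Ici t).indicator (fun _ => (1 : ℝ)) x =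
      (Set.Ici t).indicator (fun x => Real.exp (-x)) x := fun x => by
    by_cases h : t ≤ x <;> simp [Set.indicator, h]
  simp_rw [this]
  rw [← integral_Ici_eq_integral_Ioi, setIntegral_indicator measurableSet_Ici, Set.Ici_inter_Ici,
    sup_eq_right.2 ht, integral_Ici_eq_integral_Ioi, integral_exp_neg_Ioi]

lemma setIntegral_id_expMeasure_one {t : ℝ} (ht : 0 ≤ t) :
    ∫ x, (Set.Ici t).indicator (fun x => x) x ∂(expMeasure 1) = (1 + t) * Real.exp (-t) := by
  rw [integral_expMeasure_one]
  have : ∀ x, Real.exp (-x) * (Set.Ici t).indicator (fun x => x) x =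
      (Set.Ici t).indicator (fun x => Real.exp (-x) * x) x := fun x => by
    by_cases h : t ≤ x <;> simp [Set.indicator, h]
  simp_rw [this]
  rw [← integral_Ici_eq_integral_Ioi, setIntegral_indicator measurableSet_Ici, Set.Ici_inter_Ici,
    sup_eq_right.2 ht, integral_Ici_eq_integral_Ioi]
  have hd : ∀ x ∈ Set.Ici t, HasDerivAt (fun x => -((1 + x) * Real.exp (-x)))
      (Real.exp (-x) * x) x := fun x _ => by
    have h1 : HasDerivAt (fun x : ℝ => Real.exp (-x)) (-Real.exp (-x)) x := by
      simpa using (hasDerivAt_neg x).exp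
    have h2 := (((hasDerivAt_id x).const_add 1).mul h1).neg
    refine h2.congr_deriv ?_
    simp only [id]
    ring
  have hi : IntegrableOn (fun x => Real.exp (-x) * x) (Set.Ioi t) :=
    ((integrable_expMeasure_one_iff _).1 integrable_id_expMeasure_one).mono_set
      (Set.Ioi_subset_Ioi ht)
  have hl : Tendsto (fun x : ℝ => -((1 + x) * Real.exp (-x))) atTop (𝓝 0) := by
    have h0 := Real.tendsto_pow_mul_exp_neg_atTop_nhds_zero 0
    have h1 := Real.tendsto_pow_mul_exp_neg_atTop_nhds_zero 1
    have := (h0.add h1).neg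
    simp only [add_zero, neg_zero] at this
    refine this.congr fun x => ?_
    ring
  rw [integral_Ioi_of_hasDerivAt_of_tendsto' hd hi hl]
  ring

/-- A weak law of large numbers for product measures. -/
lemma tendsto_measure_sum_ge {ν : Measure ℝ} [IsProbabilityMeasure ν] {φ : ℝ → ℝ}
    (hφ : MemLp φ 2 ν) {a : ℝ} (ha : ∫ x, φ x ∂ν < a) :
    Tendsto (fun n : ℕ => (Measure.pi fun _ : Fin n => ν) {y | n * a ≤ ∑ i, φ (y i)})
      atTop (𝓝 0) := by
  set d := a - ∫ x, φ x ∂ν with hd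
  have hd0 : 0 < d := sub_pos.2 ha
  have hb : ∀ n : ℕ, 0 < n → (Measure.pi fun _ : Fin n => ν) {y | n * a ≤ ∑ i, φ (y i)} ≤
      ENNReal.ofReal (Var[φ; ν] / d ^ 2 * (n : ℝ)⁻¹) := by
    intro n hn
    have hn' : (0 : ℝ) < n := by exact_mod_cast hn
    set P := Measure.pi fun _ : Fin n => ν
    have hmp : ∀ i : Fin n, MeasurePreserving (fun y : Fin n → ℝ => y i) P ν :=
      fun i => measurePreserving_eval _ i
    have hX : ∀ i : Fin n, MemLp (fun y : Fin n → ℝ => φ (y i)) 2 P :=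
      fun i => hφ.comp_measurePreserving (hmp i)
    have hS : MemLp (∑ i, fun y : Fin n → ℝ => φ (y i)) 2 P := memLp_finsetSum' _ fun i _ => hX i
    have hE : P[∑ i, fun y : Fin n → ℝ => φ (y i)] = n * ∫ x, φ x ∂ν := by
      simp only [Finset.sum_apply]
      rw [integral_finsetSum _ fun i _ => (hX i).integrable (by norm_num)]
      have : ∀ i : Fin n, ∫ y, φ (y i) ∂P = ∫ x, φ x ∂ν := fun i => by
        rw [← (hmp i).map_eq, integral_map (hmp i).measurable.aemeasurable]
        rw [(hmp i).map_eq]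
        exact hφ.aestronglyMeasurable
      simp [this]
    have hV : Var[∑ i, fun y : Fin n → ℝ => φ (y i); P] = n * Var[φ; ν] := by
      rw [variance_sum_pi (X := fun _ => φ) fun _ => hφ]
      simp
    have hc := meas_ge_le_variance_div_sq hS (c := n * d) (by positivity)
    rw [hE, hV] at hc
    refine (measure_mono fun y hy => ?_).trans (hc.trans_eq ?_)
    · simp only [Set.mem_ofPred_eq, Finset.sum_apply] at hy ⊢
      refine le_trans ?_ (le_abs_self _)
      rw [hd]
      linarith
    · congr 1
      field_simp
  have hl : Tendsto (fun n : ℕ => ENNReal.ofReal (Var[φ; ν] / d ^ 2 * (n : ℝ)⁻¹)) atTop (𝓝 0) := by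
    have := (tendsto_inv_atTop_nhds_zero_nat (𝕜 := ℝ)).const_mul (Var[φ; ν] / d ^ 2)
    simpa using ENNReal.tendsto_ofReal this
  refine tendsto_of_tendsto_of_tendsto_of_le_of_le' tendsto_const_nhds hl
    (Eventually.of_forall fun _ => zero_le) ?_
  filter_upwards [eventually_gt_atTop 0] with n hn using hb n hn

lemma tendsto_measure_sum_le {ν : Measure ℝ} [IsProbabilityMeasure ν] {φ : ℝ → ℝ}
    (hφ : MemLp φ 2 ν) {a : ℝ} (ha : a < ∫ x, φ x ∂ν) :
    Tendsto (fun n : ℕ => (Measure.pi fun _ : Fin n => ν) {y | ∑ i, φ (y i) ≤ n * a})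
      atTop (𝓝 0) := by
  have h := tendsto_measure_sum_ge hφ.neg (a := -a) (by simpa [integral_neg] using ha)
  simpa using h

end SIC

/-! ### Order statistics and deterministic decoding criteria -/

namespace SIC

variable {n : ℕ}

/-- The number of entries of `y` that are at least `t`. -/
noncomputable def countGe (t : ℝ) (y : Fin n → ℝ) : ℕ :=
  (Finset.univ.filter fun i => t ≤ y i).card

lemma antitone_orderStat (y : Fin n → ℝ) : Antitone (orderStat y) := fun i j hij => by
  have := Tuple.monotone_sort (fun i => -y i) hij
  simpa [orderStat] using this

lemma sum_comp_orderStat (φ : ℝ → ℝ) (y : Fin n → ℝ) :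
    ∑ r, φ (orderStat y r) = ∑ i, φ (y i) :=
  Equiv.sum_comp (Tuple.sort fun i => -y i) fun i => φ (y i)

lemma card_le_orderStat (t : ℝ) (y : Fin n → ℝ) :
    (Finset.univ.filter fun r => t ≤ orderStat y r).card = countGe t y := by
  have h := Equiv.sum_comp (Tuple.sort fun i => -y i) fun i => if t ≤ y i then 1 else 0
  rw [countGe, Finset.card_filter, Finset.card_filter]
  exact h

lemma le_orderStat_iff (t : ℝ) (y : Fin n → ℝ) (k : Fin n) :
    t ≤ orderStat y k ↔ (k : ℕ) < countGe t y := by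
  rw [← card_le_orderStat, Tuple.lt_card_ge_iff_apply_ge_of_antitone (antitone_orderStat y)]

lemma orderStat_nonneg {y : Fin n → ℝ} (hy : ∀ i, 0 ≤ y i) (k : Fin n) : 0 ≤ orderStat y k :=
  hy _

lemma countGe_le (t : ℝ) (y : Fin n → ℝ) : countGe t y ≤ n :=
  (Finset.card_le_univ _).trans_eq (Fintype.card_fin n)

lemma numDecoded_le (c ξ γ : ℝ) (y : Fin n → ℝ) : numDecoded c ξ γ y ≤ n :=
  (Finite.card_subtype_le _).trans_eq (Nat.card_fin n)

lemma countGe_cast (t : ℝ) (y : Fin n → ℝ) :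
    (countGe t y : ℝ) = ∑ i, (Set.Ici t).indicator (fun _ => (1 : ℝ)) (y i) := by
  simp [countGe, Set.indicator]

lemma measurable_countGe (t : ℝ) : Measurable fun y : Fin n → ℝ => countGe t y := by
  simp only [countGe, Finset.card_filter]
  refine Finset.measurable_sum _ fun i _ => Measurable.ite ?_ measurable_const measurable_const
  exact measurableSet_le measurable_const (measurable_pi_apply i)

/-- Superlevel sets are counting events, which avoids the measurability of the sorting permutation.
-/
lemma measurable_orderStat (k : Fin n) : Measurable fun y : Fin n → ℝ => orderStat y k := by
  refine measurable_of_Ici fun t => ?_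
  have : (fun y : Fin n → ℝ => orderStat y k) ⁻¹' Set.Ici t = {y | (k : ℕ) < countGe t y} := by
    ext y
    exact le_orderStat_iff t y k
  rw [this]
  exact measurableSet_lt measurable_const (measurable_countGe t)

lemma measurable_snir (c ξ γ : ℝ) (j : Fin n) : Measurable fun y : Fin n → ℝ => snir c ξ γ y j := by
  have h := fun k : Fin n => measurable_orderStat k
  unfold snir
  fun_prop

lemma measurable_numDecoded (c ξ γ : ℝ) :
    Measurable fun y : Fin n → ℝ => numDecoded c ξ γ y := by
  classical
  have h : ∀ y : Fin n → ℝ, numDecoded c ξ γ y =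
      ∑ m, if IsDecoded c ξ γ y m then 1 else 0 := fun y => by
    rw [numDecoded, Nat.card_eq_fintype_card, Fintype.card_subtype, Finset.card_filter]
  simp only [h]
  refine Finset.measurable_sum _ fun m _ => Measurable.ite ?_ measurable_const measurable_const
  simp only [IsDecoded, Set.ofPred_forall]
  exact MeasurableSet.iInter fun j => MeasurableSet.iInter fun _ =>
    measurableSet_le measurable_const (measurable_snir c ξ γ j)

/-- A failure at rank `N` blocks all later ranks. If `N ≥ n` there is no such rank and the bound is
trivial. -/
lemma numDecoded_le_of_forall {c ξ γ : ℝ} {y : Fin n → ℝ} {N : ℕ}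
    (h : ∀ j : Fin n, (j : ℕ) = N → snir c ξ γ y j < γ) : numDecoded c ξ γ y ≤ N := by
  classical
  rw [numDecoded, Nat.card_eq_fintype_card, Fintype.card_subtype]
  calc _ ≤ (Finset.univ.filter fun m : Fin n => (m : ℕ) < N).card := by
        refine Finset.card_le_card fun m hm => ?_
        simp only [Finset.mem_filter, Finset.mem_univ, true_and] at hm ⊢
        by_contra! hNm
        exact (h ⟨N, hNm.trans_lt m.2⟩ rfl).not_ge (hm _ hNm)
    _ ≤ N := by
        rw [Fin.card_filter_val_lt]
        exact min_le_right _ _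

lemma countGe_le_numDecoded {c ξ γ τ : ℝ} {y : Fin n → ℝ}
    (h : ∀ j : Fin n, τ ≤ orderStat y j → γ ≤ snir c ξ γ y j) :
    countGe τ y ≤ numDecoded c ξ γ y := by
  classical
  rw [numDecoded, Nat.card_eq_fintype_card, Fintype.card_subtype, ← card_le_orderStat]
  refine Finset.card_le_card fun m hm => ?_
  simp only [Finset.mem_filter, Finset.mem_univ, true_and] at hm ⊢
  exact fun j hj => h j (hm.trans (antitone_orderStat y hj))

lemma sum_interference (ξ : ℝ) (Y : Fin n → ℝ) (j : Fin n) :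
    ∑ r ∈ Finset.Ioi j, Y r + ξ * ∑ r ∈ Finset.Iio j, Y r =
      ∑ r, ((if j < r then Y r else 0) + if r < j then ξ * Y r else 0) := by
  rw [Finset.sum_add_distrib, ← Finset.sum_filter, ← Finset.sum_filter, Finset.mul_sum,
    Finset.filter_lt_eq_Ioi, Finset.filter_gt_eq_Iio]

lemma le_snir_iff {c ξ α : ℝ} (hc : 0 < c) (hξ : 0 ≤ ξ) (hα : 0 < α) {y : Fin n → ℝ}
    (hy : ∀ i, 0 ≤ y i) (j : Fin n) :
    1 / (α * n) ≤ snir c ξ (1 / (α * n)) y j ↔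
      ∑ r ∈ Finset.Ioi j, orderStat y r + ξ * ∑ r ∈ Finset.Iio j, orderStat y r ≤
        n * (α * (orderStat y j - c)) := by
  have hn : (0 : ℝ) < n := by exact_mod_cast j.pos
  have h1 : 0 ≤ ∑ r ∈ Finset.Ioi j, orderStat y r :=
    Finset.sum_nonneg fun r _ => orderStat_nonneg hy r
  have h2 : 0 ≤ ∑ r ∈ Finset.Iio j, orderStat y r :=
    Finset.sum_nonneg fun r _ => orderStat_nonneg hy r
  have h3 := mul_nonneg hξ h2
  have h4 : c / (1 / (α * n)) = c * (α * n) := by field_simp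
  rw [snir, h4, le_div_iff₀ (by positivity), div_mul_eq_mul_div, div_le_iff₀ (by positivity)]
  constructor <;> intro h <;> linarith

/-- A packet is decodable if its power exceeds what an upper bound `φ` of the interference
requires. -/
lemma le_snir_of_sum_le {c ξ α v : ℝ} (hc : 0 < c) (hξ : 0 ≤ ξ) (hα : 0 < α) {y : Fin n → ℝ}
    (hy : ∀ i, 0 ≤ y i) {j : Fin n} {φ : ℝ → ℝ} (h0 : ∀ w, 0 ≤ w → 0 ≤ φ w)
    (hle : ∀ w, 0 ≤ w → w ≤ orderStat y j → w ≤ φ w)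
    (hge : ∀ w, orderStat y j ≤ w → ξ * w ≤ φ w)
    (hv : v ≤ orderStat y j) (hφ : ∑ i, φ (y i) ≤ n * (α * (v - c))) :
    1 / (α * n) ≤ snir c ξ (1 / (α * n)) y j := by
  rw [le_snir_iff hc hξ hα hy]
  have h : n * (α * (v - c)) ≤ n * (α * (orderStat y j - c)) := by gcongr
  refine le_trans ?_ (hφ.trans h)
  rw [sum_interference, ← sum_comp_orderStat]
  refine Finset.sum_le_sum fun r _ => ?_
  rcases lt_trichotomy j r with hr | rfl | hr
  · simpa [hr, hr.not_gt] using hle _ (orderStat_nonneg hy r) (antitone_orderStat y hr.le)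
  · simpa using h0 _ (orderStat_nonneg hy j)
  · simpa [hr, hr.not_gt] using hge _ (antitone_orderStat y hr.le)

/-- The contribution of a packet of power `w` to the interference, when packets of power at least
`t` do not count fully and packets of power at least `s` leave the residual fraction `ξ`. -/
noncomputable def load (ξ s t w : ℝ) : ℝ :=
  w - (Set.Ici t).indicator (fun w => w) w + ξ * (Set.Ici s).indicator (fun w => w) w

lemma numDecoded_le_countGe {c ξ α τ : ℝ} (hc : 0 < c) (hξ : 0 ≤ ξ) (hα : 0 < α)
    {y : Fin n → ℝ} (hy : ∀ i, 0 ≤ y i)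
    (h : n * (α * (τ - c)) + τ < ∑ i, load ξ τ τ (y i)) :
    numDecoded c ξ (1 / (α * n)) y ≤ countGe τ y := by
  refine numDecoded_le_of_forall fun j hj => ?_
  by_contra! hs
  rw [le_snir_iff hc hξ hα hy] at hs
  have hjτ : orderStat y j < τ := by
    rw [← not_le, le_orderStat_iff, hj]
    exact lt_irrefl _
  have h1 : ∑ i, load ξ τ τ (y i) ≤
      ∑ r ∈ Finset.Ioi j, orderStat y r + ξ * ∑ r ∈ Finset.Iio j, orderStat y r + τ := by
    -- The load includes the packet's own power, which is not interference; the extra `τ` pays for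
    -- it.
    have hτs : τ = ∑ r, if r = j then τ else 0 := by simp
    rw [sum_interference, ← sum_comp_orderStat]
    nth_rw 3 [hτs]
    rw [← Finset.sum_add_distrib]
    refine Finset.sum_le_sum fun r _ => ?_
    rcases lt_trichotomy j r with hr | rfl | hr
    · have : orderStat y r < τ := (antitone_orderStat y hr.le).trans_lt hjτ
      simp [load, hr, hr.not_gt, hr.ne', Set.indicator, this.not_ge]
    · simp [load, Set.indicator, hjτ.not_ge, hjτ.le]
    · have : τ ≤ orderStat y r := by
        rw [le_orderStat_iff, ← hj]
        exact hr
      simp [load, hr, hr.not_gt, hr.ne, Set.indicator, this]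
  have h2 : n * (α * (orderStat y j - c)) ≤ n * (α * (τ - c)) := by gcongr
  linarith

end SIC

/-! ### High-probability events and mean bounds -/

namespace SIC

lemma ae_pi_nonneg (n : ℕ) :
    ∀ᵐ y ∂(Measure.pi fun _ : Fin n => expMeasure 1), ∀ i, 0 ≤ y i := by
  rw [eventually_all]
  intro i
  exact (measurePreserving_eval (fun _ : Fin n => expMeasure 1) i).quasiMeasurePreserving.ae
    ae_expMeasure_one_nonneg

lemma memLp_indicator_id (t : ℝ) :
    MemLp ((Set.Ici t).indicator fun w : ℝ => w) 2 (expMeasure 1) :=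
  memLp_two_id_expMeasure_one.indicator measurableSet_Ici

lemma memLp_load (ξ s t : ℝ) : MemLp (load ξ s t) 2 (expMeasure 1) :=
  (memLp_two_id_expMeasure_one.sub (memLp_indicator_id t)).add ((memLp_indicator_id s).const_mul ξ)

lemma integral_id_expMeasure_one : ∫ x, x ∂(expMeasure 1) = 1 := by
  have h := setIntegral_id_expMeasure_one le_rfl
  rw [integral_congr_ae (g := fun x => x)] at h
  · simpa using h
  · filter_upwards [ae_expMeasure_one_nonneg] with x hx
    simp [Set.indicator, hx]

lemma integral_load (ξ : ℝ) {s t : ℝ} (hs : 0 ≤ s) (ht : 0 ≤ t) :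
    ∫ x, load ξ s t x ∂(expMeasure 1) =
      1 - (1 + t) * Real.exp (-t) + ξ * ((1 + s) * Real.exp (-s)) := by
  have h2 := fun t => (memLp_indicator_id t).integrable one_le_two
  have h1 : Integrable (fun w : ℝ => w - (Set.Ici t).indicator (fun w => w) w) (expMeasure 1) :=
    integrable_id_expMeasure_one.sub (h2 t)
  unfold load
  rw [integral_add h1 ((h2 s).const_mul ξ),
    integral_sub integrable_id_expMeasure_one (h2 t), integral_const_mul,
    setIntegral_id_expMeasure_one hs, setIntegral_id_expMeasure_one ht, integral_id_expMeasure_one]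

/-- The event that some packet with power in `S` fails its decoding condition. -/
def failSet (c ξ α : ℝ) (S : Set ℝ) (n : ℕ) : Set (Fin n → ℝ) :=
  {y | ∃ j, orderStat y j ∈ S ∧ snir c ξ (1 / (α * n)) y j < 1 / (α * n)}

/-- One `φ` dominates the interference at every power in `S`, so a single weak law controls all
these packets at once. -/
lemma tendsto_failSet_of_integral_lt {c ξ α v : ℝ} (hc : 0 < c) (hξ : 0 ≤ ξ) (hα : 0 < α)
    {S : Set ℝ} {φ : ℝ → ℝ} (hφ : MemLp φ 2 (expMeasure 1)) (hS : ∀ u ∈ S, v ≤ u)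
    (h0 : ∀ w, 0 ≤ w → 0 ≤ φ w) (hle : ∀ u ∈ S, ∀ w, 0 ≤ w → w ≤ u → w ≤ φ w)
    (hge : ∀ u ∈ S, ∀ w, 0 ≤ u → u ≤ w → ξ * w ≤ φ w)
    (hint : ∫ x, φ x ∂(expMeasure 1) < α * (v - c)) :
    Tendsto (fun n : ℕ => (Measure.pi fun _ : Fin n => expMeasure 1) (failSet c ξ α S n))
      atTop (𝓝 0) := by
  refine tendsto_of_tendsto_of_tendsto_of_le_of_le tendsto_const_nhds
    (tendsto_measure_sum_ge hφ hint) (fun _ => zero_le) fun n => ?_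
  refine measure_mono_ae ?_
  filter_upwards [ae_pi_nonneg n] with y hy
  rintro ⟨j, hj, hlt⟩
  by_contra hcon
  have hcon' : ∑ i, φ (y i) < n * (α * (v - c)) := not_le.1 hcon
  exact hlt.not_ge (le_snir_of_sum_le hc hξ hα hy h0 (hle _ hj)
    (fun w => hge _ hj w (orderStat_nonneg hy j)) (hS _ hj) hcon'.le)

/-- Worst case on the interval: powers in `[s, t)` are charged both fully and residually, against
the smallest signal `s`. -/
lemma tendsto_failSet_Ico {c ξ α s t : ℝ} (hc : 0 < c) (hξ : 0 ≤ ξ) (hα : 0 < α)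
    (hs : 0 ≤ s) (ht : 0 ≤ t)
    (h : 1 - (1 + t) * Real.exp (-t) + ξ * ((1 + s) * Real.exp (-s)) < α * (s - c)) :
    Tendsto (fun n : ℕ => (Measure.pi fun _ : Fin n => expMeasure 1)
      (failSet c ξ α (Set.Ico s t) n)) atTop (𝓝 0) := by
  refine tendsto_failSet_of_integral_lt (v := s) hc hξ hα (memLp_load ξ s t) (fun u hu => hu.1)
    (fun w hw => ?_) (fun u hu w hw hwu => ?_) (fun u hu w hu0 huw => ?_)
    (by rwa [integral_load ξ hs ht])
  · have := mul_nonneg hξ hw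
    by_cases h1 : t ≤ w <;> by_cases h2 : s ≤ w <;> simp [load, Set.indicator, h1, h2] <;>
      linarith
  · have := mul_nonneg hξ hw
    have h1 : ¬ t ≤ w := (hwu.trans_lt hu.2).not_ge
    by_cases h2 : s ≤ w <;> simp [load, Set.indicator, h1, h2, this]
  · have h2 : s ≤ w := hu.1.trans huw
    have hw : 0 ≤ w := hu0.trans huw
    by_cases h1 : t ≤ w <;> simp [load, Set.indicator, h1, h2, hw]

lemma tendsto_failSet_Ici_of_large {c ξ α M : ℝ} (hc : 0 < c) (hξ : 0 ≤ ξ) (hξ₁ : ξ ≤ 1)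
    (hα : 0 < α) (h : 1 < α * (M - c)) :
    Tendsto (fun n : ℕ => (Measure.pi fun _ : Fin n => expMeasure 1)
      (failSet c ξ α (Set.Ici M) n)) atTop (𝓝 0) := by
  refine tendsto_failSet_of_integral_lt (v := M) hc hξ hα memLp_two_id_expMeasure_one
    (fun u hu => hu) (fun w hw => hw) (fun u hu w hw hwu => le_rfl) (fun u hu w hu0 huw => ?_)
    (by rwa [integral_id_expMeasure_one])
  exact mul_le_of_le_one_left (hu0.trans huw) hξ₁

lemma tendsto_failSet_union {c ξ α : ℝ} {S T : Set ℝ}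
    (hS : Tendsto (fun n : ℕ => (Measure.pi fun _ : Fin n => expMeasure 1)
      (failSet c ξ α S n)) atTop (𝓝 0))
    (hT : Tendsto (fun n : ℕ => (Measure.pi fun _ : Fin n => expMeasure 1)
      (failSet c ξ α T n)) atTop (𝓝 0)) :
    Tendsto (fun n : ℕ => (Measure.pi fun _ : Fin n => expMeasure 1)
      (failSet c ξ α (S ∪ T) n)) atTop (𝓝 0) := by
  have h := hS.add hT
  rw [add_zero] at h
  refine tendsto_of_tendsto_of_tendsto_of_le_of_le tendsto_const_nhds h (fun _ => zero_le)
    fun n => (measure_mono ?_).trans (measure_union_le _ _)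
  rintro y ⟨j, hj | hj, hlt⟩
  exacts [Or.inl ⟨j, hj, hlt⟩, Or.inr ⟨j, hj, hlt⟩]

lemma tendsto_failSet_mono {c ξ α : ℝ} {S T : Set ℝ} (hST : S ⊆ T)
    (hT : Tendsto (fun n : ℕ => (Measure.pi fun _ : Fin n => expMeasure 1)
      (failSet c ξ α T n)) atTop (𝓝 0)) :
    Tendsto (fun n : ℕ => (Measure.pi fun _ : Fin n => expMeasure 1)
      (failSet c ξ α S n)) atTop (𝓝 0) :=
  tendsto_of_tendsto_of_tendsto_of_le_of_le tendsto_const_nhds hT (fun _ => zero_le)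
    fun _ => measure_mono fun _ ⟨j, hj, hlt⟩ => ⟨j, hST hj, hlt⟩

/-- If the limiting condition holds strictly at all powers `t ≥ τ`, then with high probability no
packet of power at least `τ` fails. -/
lemma tendsto_failSet_Ici {c ξ α τ : ℝ} (hc : 0 < c) (hξ : 0 ≤ ξ) (hξ₁ : ξ ≤ 1) (hα : 0 < α)
    (hτ : 0 < τ)
    (h : ∀ t, τ ≤ t →
      1 - (1 + t) * Real.exp (-t) + ξ * ((1 + t) * Real.exp (-t)) < α * (t - c)) :
    Tendsto (fun n : ℕ => (Measure.pi fun _ : Fin n => expMeasure 1)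
      (failSet c ξ α (Set.Ici τ) n)) atTop (𝓝 0) := by
  obtain ⟨M, hM⟩ : ∃ M, 1 < α * (M - c) := ⟨c + 2 / α, by
    rw [add_sub_cancel_left, mul_div_cancel₀ _ hα.ne']
    norm_num⟩
  refine tendsto_failSet_mono (T := Set.Icc τ M ∪ Set.Ici M) (fun u hu => ?_)
    (tendsto_failSet_union ?_ (tendsto_failSet_Ici_of_large hc hξ hξ₁ hα hM))
  · rcases le_total u M with huM | huM
    exacts [Or.inl ⟨hu, huM⟩, Or.inr huM]
  -- Vanishing failure probability passes to subsets and finite unions, so it need only hold near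
  -- each point.
  refine isCompact_Icc.induction_on
    (p := fun S => Tendsto (fun n : ℕ => (Measure.pi fun _ : Fin n => expMeasure 1)
      (failSet c ξ α S n)) atTop (𝓝 0)) ?_ (fun _ _ => tendsto_failSet_mono)
    (fun _ _ => tendsto_failSet_union) fun v hv => ?_
  · simp [failSet]
  have hv0 : 0 < v := hτ.trans_le hv.1
  have hcont : ContinuousAt (fun d : ℝ => α * (v - d - c) - (1 - (1 + (v + d)) *
      Real.exp (-(v + d)) + ξ * ((1 + (v - d)) * Real.exp (-(v - d))))) 0 := by fun_prop
  have hpos := hcont.eventually (lt_mem_nhds (a := 0) (by simpa using h v hv.1))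
  obtain ⟨d, ⟨hd1, hdv⟩, hd0⟩ := (((hpos.and (gt_mem_nhds hv0)).filter_mono
    (nhdsWithin_le_nhds (s := Set.Ioi 0))).and (eventually_mem_of_tendsto_nhdsWithin
      tendsto_id)).exists
  have hd0 : 0 < d := hd0
  refine ⟨Set.Ico (v - d) (v + d), mem_nhdsWithin_of_mem_nhds
    (Ico_mem_nhds (by linarith) (by linarith)), ?_⟩
  exact tendsto_failSet_Ico hc hξ hα (by linarith) (by linarith) (by linarith)

lemma integral_le_integral_add_of_le_off {n : ℕ} {P : Measure (Fin n → ℝ)} [IsProbabilityMeasure P]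
    {f g : (Fin n → ℝ) → ℕ} (hf : Measurable f) (hg : Measurable g) (hfn : ∀ y, f y ≤ n)
    (hgn : ∀ y, g y ≤ n) (B : Set (Fin n → ℝ)) (h : ∀ᵐ y ∂P, y ∉ B → f y ≤ g y) :
    ∫ y, (f y : ℝ) ∂P ≤ ∫ y, (g y : ℝ) ∂P + n * P.real B := by
  have hi : ∀ {u : (Fin n → ℝ) → ℕ}, Measurable u → (∀ y, u y ≤ n) →
      Integrable (fun y => (u y : ℝ)) P := fun hu hun =>
    Integrable.of_bound (C := n) (measurable_from_nat.comp hu).aestronglyMeasurable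
      (Eventually.of_forall fun y => by simpa using hun y)
  -- `B` need not be measurable; its measurable hull has the same mass.
  have hB : Integrable ((toMeasurable P B).indicator fun _ => (n : ℝ)) P :=
    (integrable_const _).indicator (measurableSet_toMeasurable P B)
  have hBe : ∫ y, (toMeasurable P B).indicator (fun _ => (n : ℝ)) y ∂P = n * P.real B := by
    rw [integral_indicator_const _ (measurableSet_toMeasurable P B), measureReal_def,
      measure_toMeasurable, smul_eq_mul, mul_comm, measureReal_def]
  rw [← hBe, ← integral_add (hi hg hgn) hB]
  refine integral_mono_ae (hi hf hfn) ((hi hg hgn).add hB) ?_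
  filter_upwards [h] with y hy
  by_cases hyB : y ∈ toMeasurable P B
  · have h1 : (f y : ℝ) ≤ n := by exact_mod_cast hfn y
    have h2 : (0 : ℝ) ≤ g y := Nat.cast_nonneg _
    simp only [hyB, Set.indicator_of_mem]
    linarith
  · have : f y ≤ g y := hy fun hh => hyB (subset_toMeasurable P B hh)
    simpa [hyB] using this

lemma integral_countGe (n : ℕ) {t : ℝ} (ht : 0 ≤ t) :
    ∫ y, (countGe t y : ℝ) ∂(Measure.pi fun _ : Fin n => expMeasure 1) = n * Real.exp (-t) := by
  have hm : Measurable ((Set.Ici t).indicator fun _ => (1 : ℝ)) :=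
    measurable_const.indicator measurableSet_Ici
  have hint : Integrable ((Set.Ici t).indicator fun _ => (1 : ℝ)) (expMeasure 1) :=
    (integrable_const _).indicator measurableSet_Ici
  have hmp := fun i : Fin n => measurePreserving_eval (fun _ : Fin n => expMeasure 1) i
  simp only [countGe_cast]
  rw [integral_finsetSum (f := fun i (y : Fin n → ℝ) =>
    (Set.Ici t).indicator (fun _ => (1 : ℝ)) (y i)) _
    fun i _ => (hmp i).integrable_comp_of_integrable hint]
  have : ∀ i : Fin n, ∫ y, (Set.Ici t).indicator (fun _ => (1 : ℝ)) (y i)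
      ∂(Measure.pi fun _ : Fin n => expMeasure 1) = Real.exp (-t) := fun i => by
    rw [← setIntegral_one_expMeasure_one ht]
    conv_rhs => rw [← (hmp i).map_eq]
    exact (integral_map (hmp i).measurable.aemeasurable hm.aestronglyMeasurable).symm
  simp [this]

lemma tendsto_measureReal {P : (n : ℕ) → Measure (Fin n → ℝ)} {B : (n : ℕ) → Set (Fin n → ℝ)}
    (h : Tendsto (fun n => P n (B n)) atTop (𝓝 0)) :
    Tendsto (fun n => (P n).real (B n)) atTop (𝓝 0) := by
  exact (ENNReal.tendsto_toReal ENNReal.zero_ne_top).comp h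

lemma eventually_lt_meanDecoded_div {c ξ α τ x : ℝ} (hc : 0 < c) (hξ : 0 ≤ ξ) (hξ₁ : ξ ≤ 1)
    (hα : 0 < α) (hτ : 0 < τ)
    (h : ∀ t, τ ≤ t →
      1 - (1 + t) * Real.exp (-t) + ξ * ((1 + t) * Real.exp (-t)) < α * (t - c))
    (hx : x < Real.exp (-τ)) :
    ∀ᶠ n : ℕ in atTop, x < meanDecoded c ξ n (1 / (α * n)) / n := by
  have hB := tendsto_measureReal (tendsto_failSet_Ici hc hξ hξ₁ hα hτ h)
  filter_upwards [hB.eventually (gt_mem_nhds (sub_pos.2 hx)), eventually_gt_atTop 0] with n hn hn0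
  have hn0' : (0 : ℝ) < n := by exact_mod_cast hn0
  have := integral_le_integral_add_of_le_off (P := Measure.pi fun _ : Fin n => expMeasure 1)
    (measurable_countGe τ) (measurable_numDecoded c ξ (1 / (α * n))) (countGe_le τ)
    (numDecoded_le c ξ _) (failSet c ξ α (Set.Ici τ) n) (Eventually.of_forall fun y hy =>
      countGe_le_numDecoded fun j hj => not_lt.1 fun hlt => hy ⟨j, hj, hlt⟩)
  rw [integral_countGe n hτ.le] at this
  rw [lt_div_iff₀ hn0', meanDecoded]
  nlinarith

lemma eventually_meanDecoded_div_lt {c ξ α τ x : ℝ} (hc : 0 < c) (hξ : 0 ≤ ξ)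
    (hα : 0 < α) (hτ : 0 < τ)
    (h : α * (τ - c) < 1 - (1 + τ) * Real.exp (-τ) + ξ * ((1 + τ) * Real.exp (-τ)))
    (hx : Real.exp (-τ) < x) :
    ∀ᶠ n : ℕ in atTop, meanDecoded c ξ n (1 / (α * n)) / n < x := by
  -- The gap below `a` absorbs the term `τ / n` from the packet's own power; the gap above feeds the
  -- weak law.
  obtain ⟨a, ha1, ha2⟩ := exists_between h
  rw [← integral_load ξ hτ.le hτ.le] at ha2
  have hB := tendsto_measureReal (tendsto_measure_sum_le (memLp_load ξ τ τ) ha2)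
  have hlim : Tendsto (fun n : ℕ => τ * (n : ℝ)⁻¹) atTop (𝓝 0) := by
    simpa using (tendsto_inv_atTop_nhds_zero_nat (𝕜 := ℝ)).const_mul τ
  filter_upwards [hB.eventually (gt_mem_nhds (sub_pos.2 hx)), eventually_gt_atTop 0,
    hlim.eventually (gt_mem_nhds (sub_pos.2 ha1))] with n hn hn0 hna
  have hn0' : (0 : ℝ) < n := by exact_mod_cast hn0
  rw [← div_eq_mul_inv, div_lt_iff₀ hn0'] at hna
  have := integral_le_integral_add_of_le_off (P := Measure.pi fun _ : Fin n => expMeasure 1)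
    (measurable_numDecoded c ξ (1 / (α * n))) (measurable_countGe τ) (numDecoded_le c ξ _)
    (countGe_le τ) {y | ∑ i, load ξ τ τ (y i) ≤ n * a} (by
      filter_upwards [ae_pi_nonneg n] with y hy hyB
      refine numDecoded_le_countGe hc hξ hα hy ?_
      have hyB' : n * a < ∑ i, load ξ τ τ (y i) := not_le.1 hyB
      linarith)
  rw [integral_countGe n hτ.le] at this
  rw [div_lt_iff₀ hn0', meanDecoded]
  nlinarith

lemma meanDecoded_div_le_one (c ξ γ : ℝ) (n : ℕ) : meanDecoded c ξ n γ / n ≤ 1 := by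
  refine div_le_one_of_le₀ ?_ (Nat.cast_nonneg n)
  have := integral_le_integral_add_of_le_off (P := Measure.pi fun _ : Fin n => expMeasure 1)
    (measurable_numDecoded c ξ γ) (g := fun _ => n) measurable_const (numDecoded_le c ξ γ)
    (fun _ => le_rfl) ∅ (Eventually.of_forall fun y _ => numDecoded_le c ξ γ y)
  simpa [meanDecoded] using this

/-! ### The profile, `ζ`, and the limits -/

lemma profile_exp_neg {α : ℝ} (hα : 0 < α) (ξ c t : ℝ) :
    α * (profile α ξ (Real.exp (-t)) - c) = α * (t - c) -
      (1 - (1 + t) * Real.exp (-t) + ξ * ((1 + t) * Real.exp (-t))) := by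
  rw [profile, Real.log_exp]
  field_simp
  ring

lemma zeta_bddAbove (α ξ c : ℝ) :
    BddAbove {x | x ∈ Set.Ioc (0 : ℝ) 1 ∧ ∀ z ∈ Set.Ioo 0 x, c ≤ profile α ξ z} :=
  ⟨1, fun _ hx => hx.1.2⟩

/-- Near `0` the term `-log z` alone outweighs `c + 1/α`, and the terms with `1 - ξ` are
nonnegative. Hence `ζ > 0`. -/
lemma le_profile_of_le {α ξ c z : ℝ} (hα : 0 < α) (hξ : ξ ≤ 1) (hz0 : 0 < z) (hz1 : z ≤ 1)
    (hz : z ≤ Real.exp (-(c + 1 / α))) : c ≤ profile α ξ z := by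
  have hlog : Real.log z ≤ -(c + 1 / α) := (Real.log_le_iff_le_exp hz0).2 hz
  have h1 : 0 ≤ (1 - ξ) * z / α := by
    have := sub_nonneg.2 hξ
    positivity
  have h2 : 0 ≤ (1 - ξ) * z / α * -Real.log z :=
    mul_nonneg h1 (neg_nonneg.2 (Real.log_nonpos hz0.le hz1))
  have h3 : profile α ξ z = -Real.log z + (1 - ξ) * z / α * -Real.log z - 1 / α +
      (1 - ξ) * z / α := by
    rw [profile]
    ring
  linarith

lemma zeta_pos {α ξ c : ℝ} (hα : 0 < α) (hξ : ξ ≤ 1) (hc : 0 < c) : 0 < zeta α ξ c := by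
  have h1 : Real.exp (-(c + 1 / α)) ≤ 1 := Real.exp_le_one_iff.2 (by
    have : 0 < 1 / α := by positivity
    linarith)
  exact (Real.exp_pos _).trans_le (le_csSup (zeta_bddAbove α ξ c)
    ⟨⟨Real.exp_pos _, h1⟩, fun z hz =>
      le_profile_of_le hα hξ hz.1 (hz.2.le.trans h1) hz.2.le⟩)

lemma le_profile_of_lt_zeta {α ξ c z : ℝ} (hz0 : 0 < z) (hz : z < zeta α ξ c) :
    c ≤ profile α ξ z ∧ z < 1 := by
  have hne : {x | x ∈ Set.Ioc (0 : ℝ) 1 ∧ ∀ z ∈ Set.Ioo 0 x, c ≤ profile α ξ z}.Nonempty := by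
    by_contra hne
    rw [zeta, Set.not_nonempty_iff_eq_empty.1 hne, Real.sSup_empty] at hz
    exact hz0.not_gt hz
  obtain ⟨x, hx, hzx⟩ := exists_lt_of_lt_csSup hne hz
  exact ⟨hx.2 z ⟨hz0, hzx⟩, hzx.trans_le hx.1.2⟩

lemma exists_profile_lt_of_zeta_lt {α ξ c x : ℝ} (hx : zeta α ξ c < x) (hx0 : 0 < x)
    (hx1 : x ≤ 1) : ∃ w ∈ Set.Ioo 0 x, profile α ξ w < c := by
  by_contra! hcon
  exact hx.not_ge (le_csSup (zeta_bddAbove α ξ c) ⟨⟨hx0, hx1⟩, hcon⟩)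

lemma tendsto_meanDecoded_div {c α ξ : ℝ} (hc : 0 < c) (hα : 0 < α) (hξ₀ : 0 ≤ ξ) (hξ₁ : ξ ≤ 1)
    (hroot : ∀ z ∈ Set.Ioo 0 (zeta α ξ c), profile α ξ z ≠ c) :
    Tendsto (fun n : ℕ => meanDecoded c ξ n (1 / (α * n)) / n) atTop (𝓝 (zeta α ξ c)) := by
  have hζ := zeta_pos hα hξ₁ hc
  refine tendsto_order.2 ⟨fun x hx => ?_, fun x hx => ?_⟩
  -- The maximum with `0` keeps `w` positive, so that the threshold `-log w` makes sense.
  · obtain ⟨w, hw, hwζ⟩ := exists_between (max_lt hx hζ)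
    have hw0 : 0 < w := (le_max_right _ _).trans_lt hw
    have hwe : Real.exp (-(-Real.log w)) = w := by rw [neg_neg, Real.exp_log hw0]
    refine eventually_lt_meanDecoded_div (τ := -Real.log w) hc hξ₀ hξ₁ hα
      (neg_pos.2 (Real.log_neg hw0 (le_profile_of_lt_zeta hw0 hwζ).2)) (fun t ht => ?_)
      (hwe.symm ▸ (le_max_left _ _).trans_lt hw)
    have htw : Real.exp (-t) ≤ w := by
      rw [← hwe]
      exact Real.exp_le_exp.2 (neg_le_neg ht)
    have hmem : Real.exp (-t) ∈ Set.Ioo 0 (zeta α ξ c) := ⟨Real.exp_pos _, htw.trans_lt hwζ⟩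
    -- The root assumption excludes tangency, giving the strict margin that the weak law needs.
    have hlt := lt_of_le_of_ne (le_profile_of_lt_zeta hmem.1 hmem.2).1 (hroot _ hmem).symm
    have := profile_exp_neg hα ξ c t
    have := mul_pos hα (sub_pos.2 hlt)
    linarith
  · rcases lt_or_ge 1 x with hx1 | hx1
    · exact Eventually.of_forall fun n => (meanDecoded_div_le_one _ _ _ _).trans_lt hx1
    obtain ⟨w, ⟨hw0, hwx⟩, hw⟩ := exists_profile_lt_of_zeta_lt hx (hζ.trans hx) hx1
    have hwe : Real.exp (-(-Real.log w)) = w := by rw [neg_neg, Real.exp_log hw0]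
    refine eventually_meanDecoded_div_lt (τ := -Real.log w) hc hξ₀ hα
      (neg_pos.2 (Real.log_neg hw0 (hwx.trans_le hx1))) ?_ (hwe.symm ▸ hwx)
    have h1 := profile_exp_neg hα ξ c (-Real.log w)
    rw [hwe] at h1 ⊢
    have h2 := mul_neg_of_pos_of_neg hα (sub_neg.2 hw)
    linarith

lemma tendsto_mul_logb_one_add (α : ℝ) :
    Tendsto (fun n : ℕ => n * Real.logb 2 (1 + 1 / (α * n))) atTop
      (𝓝 (1 / (α * Real.log 2))) := by
  have h := ((Real.tendsto_mul_log_one_add_div_atTop (1 / α)).comp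
    tendsto_natCast_atTop_atTop).div_const (Real.log 2)
  rw [div_div] at h
  refine h.congr fun n => ?_
  simp only [Function.comp, Real.logb, div_div, mul_div_assoc]

end SIC

theorem theorem3 (ε α ξ : ℝ) (hε₀ : 0 < ε) (hε₁ : ε < 1) (hα : 0 < α) (hξ₀ : 0 ≤ ξ) (hξ₁ : ξ < 1)
    (hroot : ∀ z ∈ Set.Ioo 0 (SIC.zeta α ξ (SIC.outageConst ε)),
      SIC.profile α ξ z ≠ SIC.outageConst ε) :
    (fun n : ℕ => SIC.meanDecoded (SIC.outageConst ε) ξ n (1 / (α * n)))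
        ~[atTop] (fun n : ℕ => SIC.zeta α ξ (SIC.outageConst ε) * n) ∧
      Tendsto (fun n : ℕ => SIC.sumRate (SIC.outageConst ε) ξ n (1 / (α * n))) atTop
        (𝓝 (SIC.zeta α ξ (SIC.outageConst ε) / (α * Real.log 2))) := by
  have hc : 0 < SIC.outageConst ε :=
    neg_pos.2 (Real.log_neg (sub_pos.2 hε₁) (sub_lt_self _ hε₀))
  have hζ := SIC.zeta_pos hα hξ₁.le hc
  have hm := SIC.tendsto_meanDecoded_div hc hα hξ₀ hξ₁.le hroot
  have hpos : ∀ᶠ n : ℕ in atTop, (n : ℝ) ≠ 0 := by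
    filter_upwards [eventually_gt_atTop 0] with n hn using by exact_mod_cast hn.ne'
  refine ⟨?_, ?_⟩
  · rw [isEquivalent_iff_tendsto_one (by
      filter_upwards [hpos] with n hn using mul_ne_zero hζ.ne' hn)]
    have := hm.div_const (SIC.zeta α ξ (SIC.outageConst ε))
    rw [div_self hζ.ne'] at this
    refine this.congr fun n => ?_
    rw [Pi.div_apply, div_div, mul_comm (n : ℝ)]
  · have := hm.mul (SIC.tendsto_mul_logb_one_add α)
    rw [mul_one_div] at this
    refine this.congr' ?_
    filter_upwards [hpos] with n hn
    rw [SIC.sumRate]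
    field_simp
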